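/- Let $d\ge 1$, let $U$ be a random vector uniformly distributed on the unit cube $[0,1]^d$, and let $Z=\{Z(x):x\in\mathbb Z^d\}$ be a stationary family of $\mathbb R^d$-valued random vectors (that is, $\{Z(x+y)\}_{x\in\mathbb Z^d}\overset{d}{=}\{Z(x)\}_{x\in\mathbb Z^d}$ for every $y\in\mathbb Z^d$) which is independent of $U$. No moment assumption on $Z(0)$ is made. Assume that $$\sum_{y\in\mathbb Z^d}\big\|\mathbb P\big((Z(y),Z(0))\in\cdot\big)-\mathbb P(Z(0)\in\cdot)^{\otimes 2}\big\|<\infty,$$ where $\|\nu\|:=\sup\{|\int f\,d\nu| : f \text{ measurable with values in }[-1,1]\}$ is the total variation norm. Then the displaced lattice $$\Gamma:=\sum_{x\in\mathbb Z^d}\delta_{x+U+Z(x)}$$ is a stationary point process on $\mathbb R^d$: it is measurable, almost surely locally finite and $\mathbb N\cup\{\infty\}$-valued, and $\Gamma(\cdot+x)\overset{d}{=}\Gamma$ for every $x\in\mathbb R^d$. Moreover, $\Gamma$ is hyperuniform with respect to every Fourier smooth bounded convex Borel set $W\subset\mathbb R^d$ that contains $0$ in its interior; that is, $\mathbb E[\Gamma(B)^2]<\infty$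 for every bounded Borel set $B\subset\mathbb R^d$, and $$\lim_{r\to\infty}\lambda_d(rW)^{-1}\,\mathbb V\mathrm{ar}[\Gamma(rW)]=0,$$ where $\lambda_d$ is Lebesgue measure. Here a bounded Borel set $W$ is called Fourier smooth if there are $c,\vartheta>0$ such that $$\Big|\int_W e^{-i\langle k,x\rangle}\,dx\Big|\le c\,(1+\|k\|)^{-(d+\vartheta)/2},\qquad k\in\mathbb R^d.$$ -/

import Mathlib

open MeasureTheory ProbabilityTheory Filter Topology
open scoped ENNReal Pointwise

/-- The total variation norm `‖μ - ν‖` of the difference of two finite measures: the supremum of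
`|∫ f dμ - ∫ f dν|` over all measurable `f` with values in `[-1, 1]`. -/
noncomputable def tvNormSub {S : Type*} [MeasurableSpace S] (μ ν : Measure S) : ℝ≥0∞ :=
  ⨆ (f : S → ℝ) (_ : Measurable f) (_ : ∀ s, f s ∈ Set.Icc (-1 : ℝ) 1),
    ENNReal.ofReal |∫ s, f s ∂μ - ∫ s, f s ∂ν|

/-- A point of `ℤ^d`, seen as a vector of `ℝ^d`. -/
noncomputable def latticePoint {d : ℕ} (x : Fin d → ℤ) : EuclideanSpace ℝ (Fin d) :=
  WithLp.toLp 2 (fun i => (x i : ℝ))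

/-- The unit cube `[0, 1]^d`. -/
def unitCube (d : ℕ) : Set (EuclideanSpace ℝ (Fin d)) :=
  {u | ∀ i, u i ∈ Set.Icc (0 : ℝ) 1}

/-- A family `Z` indexed by `ℤ^d` is stationary: for each `y ∈ ℤ^d` the family
`(Z (x + y))_x` has the same law as `(Z x)_x` (on the product space, with the product σ-field). -/
def IsStationaryField {d : ℕ} {Ω : Type*} [MeasurableSpace Ω] (P : Measure Ω)
    (Z : (Fin d → ℤ) → Ω → EuclideanSpace ℝ (Fin d)) : Prop :=
  ∀ y : Fin d → ℤ, IdentDistrib (fun ω x => Z (x + y) ω) (fun ω x => Z x ω) P P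

/-- The displaced lattice `∑_{x ∈ ℤ^d} δ_{x + U + Z(x)}`. -/
noncomputable def displacedLattice {d : ℕ} {Ω : Type*} (U : Ω → EuclideanSpace ℝ (Fin d))
    (Z : (Fin d → ℤ) → Ω → EuclideanSpace ℝ (Fin d)) (ω : Ω) :
    Measure (EuclideanSpace ℝ (Fin d)) :=
  Measure.sum (fun x : Fin d → ℤ => Measure.dirac (latticePoint x + U ω + Z x ω))

/-- A point process: a random measure (measurable for the σ-field generated by the evaluations
`φ ↦ φ B`, `B` Borel) which is almost surely locally finite with values in `ℕ ∪ {∞}`. -/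
def IsPointProcess {d : ℕ} {Ω : Type*} [MeasurableSpace Ω] (P : Measure Ω)
    (Φ : Ω → Measure (EuclideanSpace ℝ (Fin d))) : Prop :=
  Measurable Φ ∧ ∀ᵐ ω ∂P, IsLocallyFiniteMeasure (Φ ω) ∧
    ∀ B, MeasurableSet B → ∃ n : ℕ∞, Φ ω B = (n : ℝ≥0∞)

/-- The shift `θ_x φ = φ(· + x)`, that is, `(θ_x φ) B = φ (B + x)`. -/
noncomputable def shiftMeasure {d : ℕ} (x : EuclideanSpace ℝ (Fin d))
    (φ : Measure (EuclideanSpace ℝ (Fin d))) : Measure (EuclideanSpace ℝ (Fin d)) :=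
  φ.map (fun y => y - x)

/-- A random measure `Φ` is stationary: `θ_x Φ` has the same law as `Φ` for each `x ∈ ℝ^d`. -/
def IsStationaryMeasure {d : ℕ} {Ω : Type*} [MeasurableSpace Ω] (P : Measure Ω)
    (Φ : Ω → Measure (EuclideanSpace ℝ (Fin d))) : Prop :=
  ∀ x, IdentDistrib (fun ω => shiftMeasure x (Φ ω)) Φ P P

/-- `E Φ(B)^2 < ∞` for all bounded Borel sets `B`. -/
def IsLocallySquareIntegrable {d : ℕ} {Ω : Type*} [MeasurableSpace Ω] (P : Measure Ω)
    (Φ : Ω → Measure (EuclideanSpace ℝ (Fin d))) : Prop :=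
  ∀ B, MeasurableSet B → Bornology.IsBounded B → ∫⁻ ω, (Φ ω B) ^ 2 ∂P < ∞

/-- Bounded convex sets which contain `0` in their interior. -/
def IsConvexWindow {d : ℕ} (W : Set (EuclideanSpace ℝ (Fin d))) : Prop :=
  Convex ℝ W ∧ Bornology.IsBounded W ∧ 0 ∈ interior W

/-- The Fourier transform `k ↦ ∫_B e^{-i⟨k, x⟩} dx` of the indicator function of `B`. -/
noncomputable def fourierIndicator {d : ℕ} (B : Set (EuclideanSpace ℝ (Fin d)))
    (k : EuclideanSpace ℝ (Fin d)) : ℂ :=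
  ∫ x in B, Complex.exp (-(Complex.I * ((inner ℝ k x : ℝ) : ℂ)))

/-- A bounded Borel set is Fourier smooth if the Fourier transform of its indicator function is
bounded in modulus by `c (1 + ‖k‖)^{-(d + ϑ) / 2}` for some `c, ϑ > 0`. -/
def IsFourierSmooth {d : ℕ} (B : Set (EuclideanSpace ℝ (Fin d))) : Prop :=
  MeasurableSet B ∧ Bornology.IsBounded B ∧
    ∃ c θ : ℝ, 0 < c ∧ 0 < θ ∧
      ∀ k, ‖fourierIndicator B k‖ ≤ c * (1 + ‖k‖) ^ (-((d : ℝ) + θ) / 2)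

/-- A random measure is hyperuniform with respect to `W`: it is locally square-integrable and
`λ(rW)⁻¹ Var[Φ(rW)] → 0` as `r → ∞`. -/
def IsHyperuniform {d : ℕ} {Ω : Type*} [MeasurableSpace Ω] (P : Measure Ω)
    (Φ : Ω → Measure (EuclideanSpace ℝ (Fin d))) (W : Set (EuclideanSpace ℝ (Fin d))) : Prop :=
  IsLocallySquareIntegrable P Φ ∧
    Tendsto (fun r : ℝ =>
      (volume (r • W)).toReal⁻¹ * variance (fun ω => (Φ ω (r • W)).toReal) P) atTop (𝓝 0)

/-! The variance of `Γ(B)` is at most that of the undisplaced lattice shifted by `U`, plus an error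
controlled by the dependence within `Z`. Let `g` be the autocorrelation of the indicator of `B`.
Integrating out `U` and using stationarity of `Z` gives `E Γ(B)² = ∑_z E g(z + Z(z) - Z(0))`
(`lintegral_tsum_displaced_sq`), and in the same way `E Γ(B) = λ(B)`.

Suppose first that `(Z(z), Z(0))` is replaced by an independent pair with the same marginals. Its
law no longer depends on `z`, so the sum over `z` can be taken for a fixed value `v` of the
difference. The result is the correlation of the lattice count with its translate by `v`, which is
at most the second moment of that count (`tsum_autocorrelation_le`). This bound is uniform in `v`,
which is why no moments of `Z(0)` are needed. The replacement costs `λ(B)` times `∑_z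
decouplingError P Z B z`.

Now let `B = rW`. By Parseval on the torus the lattice variance is the sum over `n ≠ 0` of
`|fourierIndicator B (2πn)|²`, and Fourier smoothness makes it `O(r^(d-ϑ)) = o(r^d)`. Each
decoupling error tends to `0`, because the normalized covariogram of `rW` tends to `1` pointwise,
and it is dominated by the `z`-th total variation norm. Summability of these norms lets dominated
convergence treat the whole series.

Stationarity of `Γ` holds because, given `U = u`, its law is `ℤ^d`-periodic in `u`. -/

/-- The half-open unit cube `(0, 1]^d`. -/
def halfOpenCube (d : ℕ) : Set (EuclideanSpace ℝ (Fin d)) :=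
  {u | ∀ i, u i ∈ Set.Ioc (0 : ℝ) 1}

/-! ### Tiling of space by integer translates of the unit cube -/

section Periodization

variable {d : ℕ}

@[simp] lemma latticePoint_apply (x : Fin d → ℤ) (i : Fin d) : latticePoint x i = (x i : ℝ) := rfl

lemma latticePoint_add (x y : Fin d → ℤ) :
    latticePoint (x + y) = latticePoint x + latticePoint y := by
  ext i; simp

lemma latticePoint_neg (x : Fin d → ℤ) : latticePoint (-x) = -latticePoint x := by
  ext i; simp

@[simp] lemma latticePoint_zero : latticePoint (0 : Fin d → ℤ) = 0 := by
  ext i; simp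

lemma halfOpenCube_eq_preimage :
    halfOpenCube d = WithLp.ofLp ⁻¹' (Set.univ.pi fun _ => Set.Ioc (0 : ℝ) 1) := by
  ext u; simp [halfOpenCube]

lemma measurableSet_halfOpenCube : MeasurableSet (halfOpenCube d) := by
  rw [halfOpenCube_eq_preimage]
  exact (MeasurableSet.univ_pi fun _ => measurableSet_Ioc).preimage (by fun_prop)

lemma volume_unitCube : volume (unitCube d) = 1 := by
  have h : unitCube d = WithLp.ofLp ⁻¹' (Set.univ.pi fun _ => Set.Icc (0 : ℝ) 1) := by
    ext u; exact Set.mem_univ_pi.symm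
  rw [h, (PiLp.volume_preserving_ofLp (Fin d)).measure_preimage
    (MeasurableSet.univ_pi fun _ => measurableSet_Icc).nullMeasurableSet, volume_pi_pi]
  simp

lemma halfOpenCube_ae_eq_unitCube : halfOpenCube d =ᵐ[volume] unitCube d := by
  have h : unitCube d = WithLp.ofLp ⁻¹' (Set.Icc (fun _ => (0 : ℝ)) (fun _ => 1)) := by
    ext u; exact forall_and.trans Iff.rfl
  rw [h, halfOpenCube_eq_preimage]
  exact (PiLp.volume_preserving_ofLp (Fin d)).quasiMeasurePreserving.preimage_ae_eq
    Measure.univ_pi_Ioc_ae_eq_Icc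

instance isProbabilityMeasure_halfOpenCube :
    IsProbabilityMeasure ((volume : Measure (EuclideanSpace ℝ (Fin d))).restrict
      (halfOpenCube d)) :=
  ⟨by rw [Measure.restrict_apply_univ, measure_congr halfOpenCube_ae_eq_unitCube,
    volume_unitCube]⟩

lemma map_eq_restrict_halfOpenCube {Ω : Type*} [MeasurableSpace Ω] {P : Measure Ω}
    {U : Ω → EuclideanSpace ℝ (Fin d)} (hU : pdf.IsUniform U (unitCube d) P volume) :
    P.map U = volume.restrict (halfOpenCube d) := by
  rw [hU, ProbabilityTheory.cond, volume_unitCube, inv_one, one_smul,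
    Measure.restrict_congr_set halfOpenCube_ae_eq_unitCube]

lemma latticePoint_add_mem_halfOpenCube_iff (z : Fin d → ℤ) (y : EuclideanSpace ℝ (Fin d)) :
    latticePoint z + y ∈ halfOpenCube d ↔ z = fun i => 1 - ⌈y i⌉ := by
  simp only [halfOpenCube, Set.mem_ofPred_eq, PiLp.add_apply, latticePoint_apply, Set.mem_Ioc,
    funext_iff]
  refine forall_congr' fun i => ?_
  rw [eq_sub_iff_add_eq, ← eq_sub_iff_add_eq', Int.ceil_eq_iff]
  push_cast
  constructor <;> rintro ⟨h1, h2⟩ <;> constructor <;> linarith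

lemma tsum_indicator_halfOpenCube (y : EuclideanSpace ℝ (Fin d)) :
    ∑' z : Fin d → ℤ,
      (halfOpenCube d).indicator (1 : EuclideanSpace ℝ (Fin d) → ℝ≥0∞) (latticePoint z + y) = 1 := by
  rw [tsum_eq_single (fun i => 1 - ⌈y i⌉)]
  · rw [Set.indicator_of_mem ((latticePoint_add_mem_halfOpenCube_iff _ _).2 rfl)]; rfl
  · intro z hz
    exact Set.indicator_of_notMem (fun h => hz ((latticePoint_add_mem_halfOpenCube_iff _ _).1 h)) _

/-- Integration over `ℝ^d` by summing over the translates of the unit cube. -/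
lemma lintegral_eq_lintegral_tsum_latticePoint {f : EuclideanSpace ℝ (Fin d) → ℝ≥0∞}
    (hf : Measurable f) :
    ∫⁻ x, f x = ∫⁻ u in halfOpenCube d, ∑' z : Fin d → ℤ, f (latticePoint z + u) := by
  have hind : Measurable ((halfOpenCube d).indicator (1 : EuclideanSpace ℝ (Fin d) → ℝ≥0∞)) :=
    measurable_one.indicator measurableSet_halfOpenCube
  calc ∫⁻ x, f x
      -- Exactly one integer translate of each point lies in the cube, so the inserted sum equals
      -- `1`.
      = ∫⁻ x, ∑' z : Fin d → ℤ,
          (halfOpenCube d).indicator 1 (latticePoint z + x) * f x := by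
        simp_rw [ENNReal.tsum_mul_right, tsum_indicator_halfOpenCube, one_mul]
    _ = ∑' z : Fin d → ℤ,
          ∫⁻ x, (halfOpenCube d).indicator 1 (latticePoint z + x) * f x :=
        lintegral_tsum fun z => by fun_prop
    _ = ∑' z : Fin d → ℤ,
          ∫⁻ x, (halfOpenCube d).indicator 1 x * f (latticePoint (-z) + x) := by
        refine tsum_congr fun z => ?_
        rw [← lintegral_add_left_eq_self _ (latticePoint (-z))]
        simp [latticePoint_neg]
    _ = ∑' z : Fin d → ℤ,
          ∫⁻ x, (halfOpenCube d).indicator 1 x * f (latticePoint z + x) :=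
        (Equiv.neg (Fin d → ℤ)).tsum_eq fun z =>
          ∫⁻ x, (halfOpenCube d).indicator 1 x * f (latticePoint z + x)
    _ = ∑' z : Fin d → ℤ, ∫⁻ u in halfOpenCube d, f (latticePoint z + u) := by
        refine tsum_congr fun z => ?_
        rw [← lintegral_indicator measurableSet_halfOpenCube]
        refine lintegral_congr fun x => ?_
        by_cases hx : x ∈ halfOpenCube d <;> simp [hx]
    _ = _ := (lintegral_tsum fun z => by fun_prop).symm

/-- The integral of a `ℤ^d`-periodic function over a unit cube does not depend on its position. -/
lemma setLIntegral_halfOpenCube_add {h : EuclideanSpace ℝ (Fin d) → ℝ≥0∞} (hh : Measurable h)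
    (hper : ∀ (z : Fin d → ℤ) u, h (latticePoint z + u) = h u) (v : EuclideanSpace ℝ (Fin d)) :
    ∫⁻ u in halfOpenCube d, h (u + v) = ∫⁻ u in halfOpenCube d, h u := by
  have hind : Measurable ((halfOpenCube d).indicator (1 : EuclideanSpace ℝ (Fin d) → ℝ≥0∞)) :=
    measurable_one.indicator measurableSet_halfOpenCube
  calc ∫⁻ u in halfOpenCube d, h (u + v)
      = ∫⁻ u, (halfOpenCube d).indicator (1 : EuclideanSpace ℝ (Fin d) → ℝ≥0∞) u * h (u + v) := by
        rw [← lintegral_indicator measurableSet_halfOpenCube]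
        refine lintegral_congr fun x => ?_
        by_cases hx : x ∈ halfOpenCube d <;> simp [hx]
    _ = ∫⁻ u, (halfOpenCube d).indicator (1 : EuclideanSpace ℝ (Fin d) → ℝ≥0∞) (u + -v) * h u := by
        rw [← lintegral_add_right_eq_self _ (-v)]
        simp
    -- After folding onto the cube, periodicity frees `h` from `z`, and the indicators of the
    -- shifted cube again sum to `1`.
    _ = ∫⁻ u in halfOpenCube d, ∑' z : Fin d → ℤ,
          (halfOpenCube d).indicator 1 (latticePoint z + (u + -v)) * h u := by
        rw [lintegral_eq_lintegral_tsum_latticePoint (by fun_prop)]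
        simp_rw [hper, add_assoc]
    _ = ∫⁻ u in halfOpenCube d, h u := by
        simp_rw [ENNReal.tsum_mul_right, tsum_indicator_halfOpenCube, one_mul]

end Periodization

/-! ### Correlations of the randomly shifted lattice -/

section LatticeCount

variable {d : ℕ}

/-- The autocorrelation `w ↦ ∫ b(t) b(t + w) dt` of a nonnegative function. -/
noncomputable def autocorrelation (b : EuclideanSpace ℝ (Fin d) → ℝ≥0∞)
    (w : EuclideanSpace ℝ (Fin d)) : ℝ≥0∞ :=
  ∫⁻ t, b t * b (t + w)

/-- The periodization `u ↦ ∑_{z ∈ ℤ^d} b(z + u)` of a nonnegative function. -/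
noncomputable def periodization (b : EuclideanSpace ℝ (Fin d) → ℝ≥0∞)
    (u : EuclideanSpace ℝ (Fin d)) : ℝ≥0∞ :=
  ∑' z : Fin d → ℤ, b (latticePoint z + u)

@[fun_prop]
lemma measurable_autocorrelation {b : EuclideanSpace ℝ (Fin d) → ℝ≥0∞} (hb : Measurable b) :
    Measurable (autocorrelation b) := by
  unfold autocorrelation
  exact Measurable.lintegral_prod_right' (f := fun p => b p.2 * b (p.2 + p.1)) (by fun_prop)

@[fun_prop]
lemma measurable_periodization {b : EuclideanSpace ℝ (Fin d) → ℝ≥0∞} (hb : Measurable b) :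
    Measurable (periodization b) := by
  unfold periodization
  fun_prop

lemma periodization_latticePoint_add (b : EuclideanSpace ℝ (Fin d) → ℝ≥0∞) (z : Fin d → ℤ)
    (u : EuclideanSpace ℝ (Fin d)) :
    periodization b (latticePoint z + u) = periodization b u := by
  unfold periodization
  rw [← (Equiv.addRight z).tsum_eq fun x => b (latticePoint x + u)]
  simp [latticePoint_add, add_assoc]

lemma ENNReal.two_mul_mul_le_sq_add_sq (a b : ℝ≥0∞) : 2 * (a * b) ≤ a ^ 2 + b ^ 2 := by
  induction a with
  | top => simp
  | coe a =>
    induction b with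
    | top => simp
    | coe b =>
      have : 2 * (a * b) ≤ a ^ 2 + b ^ 2 := by
        rw [← mul_assoc]; exact two_mul_le_add_sq a b
      exact_mod_cast this

/-- Sampling the autocorrelation of `b` along a translated lattice gives at most the second moment
of the periodization of `b`. -/
lemma tsum_autocorrelation_le {b : EuclideanSpace ℝ (Fin d) → ℝ≥0∞} (hb : Measurable b)
    (v : EuclideanSpace ℝ (Fin d)) :
    ∑' z : Fin d → ℤ, autocorrelation b (latticePoint z + v) ≤
      ∫⁻ u in halfOpenCube d, periodization b u ^ 2 := by
  -- The sum over `z` periodizes the second factor; folding the integral onto the cube then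
  -- periodizes the first.
  have key : ∑' z : Fin d → ℤ, autocorrelation b (latticePoint z + v) =
      ∫⁻ u in halfOpenCube d, periodization b u * periodization b (u + v) := by
    unfold autocorrelation
    rw [← lintegral_tsum fun z => by fun_prop]
    have h1 : ∀ t, ∑' z : Fin d → ℤ, b t * b (t + (latticePoint z + v)) =
        b t * periodization b (t + v) := fun t => by
      rw [ENNReal.tsum_mul_left, periodization]
      simp only [add_left_comm t]
    simp_rw [h1]
    rw [lintegral_eq_lintegral_tsum_latticePoint (by fun_prop)]
    simp_rw [add_assoc, periodization_latticePoint_add, ENNReal.tsum_mul_right]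
    rfl
  -- Both squares have the same integral by periodicity, so `2ab ≤ a² + b²` does the work of
  -- Cauchy–Schwarz.
  have h2 : 2 * ∫⁻ u in halfOpenCube d, periodization b u * periodization b (u + v) ≤
      2 * ∫⁻ u in halfOpenCube d, periodization b u ^ 2 := by
    have hs : ∫⁻ u in halfOpenCube d, periodization b (u + v) ^ 2 =
        ∫⁻ u in halfOpenCube d, periodization b u ^ 2 :=
      setLIntegral_halfOpenCube_add (h := fun u => periodization b u ^ 2) (by fun_prop)
        (fun z u => by simp only [periodization_latticePoint_add]) v
    rw [← lintegral_const_mul _ (by fun_prop)]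
    calc _ ≤ ∫⁻ u in halfOpenCube d, (periodization b u ^ 2 + periodization b (u + v) ^ 2) :=
          lintegral_mono fun u => ENNReal.two_mul_mul_le_sq_add_sq _ _
      _ = _ := by rw [lintegral_add_left (by fun_prop), hs, two_mul]
  rw [key]
  exact (ENNReal.mul_le_mul_iff_right (by simp) (by simp)).1 h2

/-- The number of points of a translated lattice in a bounded set is bounded. -/
lemma exists_periodization_indicator_le {B : Set (EuclideanSpace ℝ (Fin d))}
    (hB : Bornology.IsBounded B) :
    ∃ K : ℕ, ∀ u ∈ halfOpenCube d,
      periodization (B.indicator (1 : EuclideanSpace ℝ (Fin d) → ℝ≥0∞)) u ≤ K := by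
  obtain ⟨R, hR⟩ := hB.exists_norm_le
  -- From `|z i + u i| ≤ R` and `0 < u i ≤ 1` it follows that `-R - 1 ≤ z i < R`.
  let s : Finset (Fin d → ℤ) := Finset.Icc (fun _ => -(⌈R⌉ + 1)) (fun _ => ⌈R⌉)
  refine ⟨s.card, fun u hu => ?_⟩
  have hout : ∀ z ∉ s, B.indicator (1 : EuclideanSpace ℝ (Fin d) → ℝ≥0∞)
      (latticePoint z + u) = 0 := by
    intro z hz
    refine Set.indicator_of_notMem (fun hmem => hz ?_) _
    have hi : ∀ i, |(z i : ℝ) + u i| ≤ R := fun i =>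
      (PiLp.norm_apply_le (latticePoint z + u) i).trans (hR _ hmem)
    have hb : ∀ i, -(⌈R⌉ + 1) ≤ z i ∧ z i ≤ ⌈R⌉ := by
      intro i
      have h1 := abs_le.1 (hi i)
      have h2 := hu i
      have h3 := Int.le_ceil R
      simp only [Set.mem_Ioc] at h2
      constructor
      · have : (-(⌈R⌉ + 1 : ℤ) : ℝ) ≤ z i := by push_cast; linarith
        exact_mod_cast this
      · have : (z i : ℝ) ≤ ⌈R⌉ := by linarith
        exact_mod_cast this
    exact Finset.mem_Icc.2 ⟨fun i => (hb i).1, fun i => (hb i).2⟩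
  rw [periodization, tsum_eq_sum hout]
  calc _ ≤ ∑ _z ∈ s, (1 : ℝ≥0∞) := by
        refine Finset.sum_le_sum fun z _ => ?_
        exact Set.indicator_apply_le' (fun _ => le_rfl) fun _ => zero_le
    _ = s.card := by simp

lemma setLIntegral_periodization_indicator_sq_lt_top {B : Set (EuclideanSpace ℝ (Fin d))}
    (hB : Bornology.IsBounded B) :
    ∫⁻ u in halfOpenCube d,
      periodization (B.indicator (1 : EuclideanSpace ℝ (Fin d) → ℝ≥0∞)) u ^ 2 < ∞ := by
  obtain ⟨K, hK⟩ := exists_periodization_indicator_le hB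
  calc _ ≤ ∫⁻ u in halfOpenCube d, (K : ℝ≥0∞) ^ 2 :=
        setLIntegral_mono measurable_const fun u hu => by gcongr; exact hK u hu
    _ < ∞ := by simp

end LatticeCount

/-! ### Stationarity and moment formulas of the displaced lattice -/

section DisplacedLattice

variable {d : ℕ} {Ω : Type*}

lemma displacedLattice_apply (U : Ω → EuclideanSpace ℝ (Fin d))
    (Z : (Fin d → ℤ) → Ω → EuclideanSpace ℝ (Fin d)) (ω : Ω)
    {B : Set (EuclideanSpace ℝ (Fin d))} (hB : MeasurableSet B) :
    displacedLattice U Z ω B = ∑' x : Fin d → ℤ,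
      B.indicator (1 : EuclideanSpace ℝ (Fin d) → ℝ≥0∞) (latticePoint x + U ω + Z x ω) := by
  rw [displacedLattice, Measure.sum_apply _ hB]
  simp_rw [Measure.dirac_apply' _ hB]

lemma exists_displacedLattice_apply_eq (U : Ω → EuclideanSpace ℝ (Fin d))
    (Z : (Fin d → ℤ) → Ω → EuclideanSpace ℝ (Fin d)) (ω : Ω)
    {B : Set (EuclideanSpace ℝ (Fin d))} (hB : MeasurableSet B) :
    ∃ n : ℕ∞, displacedLattice U Z ω B = (n : ℝ≥0∞) := by
  refine ⟨{x : Fin d → ℤ | latticePoint x + U ω + Z x ω ∈ B}.encard, ?_⟩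
  rw [displacedLattice_apply U Z ω hB, ← ENNReal.tsum_set_one]
  exact (tsum_subtype _ fun _ => (1 : ℝ≥0∞)).symm

/-- Reindexing the sum trades an integer shift of `U` for a shift of the displacement field, which
stationarity of `Z` absorbs. The one-point space `Unit` makes the arguments deterministic. -/
lemma displacedLattice_latticePoint_add (z : Fin d → ℤ) (u : EuclideanSpace ℝ (Fin d))
    (ζ : (Fin d → ℤ) → EuclideanSpace ℝ (Fin d)) :
    displacedLattice (fun _ : Unit => latticePoint z + u) (fun x _ => ζ x) () =
      displacedLattice (fun _ : Unit => u) (fun x _ => ζ (x + -z)) () := by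
  ext B hB
  rw [displacedLattice_apply _ _ _ hB, displacedLattice_apply _ _ _ hB,
    ← (Equiv.addRight z).tsum_eq fun x => B.indicator (1 : EuclideanSpace ℝ (Fin d) → ℝ≥0∞)
      (latticePoint x + u + ζ (x + -z))]
  simp [latticePoint_add, add_assoc]

lemma shiftMeasure_displacedLattice (x u : EuclideanSpace ℝ (Fin d))
    (ζ : (Fin d → ℤ) → EuclideanSpace ℝ (Fin d)) :
    shiftMeasure x (displacedLattice (fun _ : Unit => u) (fun x _ => ζ x) ()) =
      displacedLattice (fun _ : Unit => u + -x) (fun x _ => ζ x) () := by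
  have hm : Measurable fun y : EuclideanSpace ℝ (Fin d) => y - x := by fun_prop
  ext B hB
  rw [shiftMeasure, Measure.map_apply hm hB, displacedLattice_apply _ _ _ (hm hB),
    displacedLattice_apply _ _ _ hB]
  refine tsum_congr fun z => ?_
  classical
  rw [Set.indicator_apply, Set.indicator_apply, Set.mem_preimage,
    show latticePoint z + u + ζ z - x = latticePoint z + (u + -x) + ζ z by abel]
  rfl

variable [MeasurableSpace Ω] {P : Measure Ω} {U : Ω → EuclideanSpace ℝ (Fin d)}
  {Z : (Fin d → ℤ) → Ω → EuclideanSpace ℝ (Fin d)}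

lemma IsStationaryField.lintegral_comp_add (hZ : IsStationaryField P Z) (y : Fin d → ℤ)
    {F : ((Fin d → ℤ) → EuclideanSpace ℝ (Fin d)) → ℝ≥0∞} (hF : Measurable F) :
    ∫⁻ ω, F (fun x => Z (x + y) ω) ∂P = ∫⁻ ω, F (fun x => Z x ω) ∂P :=
  ((hZ y).comp hF).lintegral_eq

lemma measurable_displacedLattice (hU : Measurable U)
    (hZ : ∀ x, Measurable (Z x)) :
    Measurable (displacedLattice U Z) := by
  refine Measure.measurable_of_measurable_coe _ fun B hB => ?_
  simp_rw [displacedLattice_apply U Z _ hB]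
  have hb : Measurable (B.indicator (1 : EuclideanSpace ℝ (Fin d) → ℝ≥0∞)) :=
    measurable_one.indicator hB
  fun_prop

variable [IsProbabilityMeasure P]

/-- Fubini for functions of the uniform variable and of the independent displacements. -/
lemma lintegral_uniform_prod (hU : Measurable U) (hUunif : pdf.IsUniform U (unitCube d) P volume)
    (hZ : ∀ x, Measurable (Z x)) (hindep : IndepFun U (fun ω x => Z x ω) P)
    {F : EuclideanSpace ℝ (Fin d) × ((Fin d → ℤ) → EuclideanSpace ℝ (Fin d)) → ℝ≥0∞}
    (hF : Measurable F) :
    ∫⁻ ω, F (U ω, fun x => Z x ω) ∂P =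
      ∫⁻ u in halfOpenCube d, ∫⁻ ω, F (u, fun x => Z x ω) ∂P := by
  have hZ' : Measurable fun ω x => Z x ω := measurable_pi_lambda _ hZ
  have h := (indepFun_iff_map_prod_eq_prod_map_map hU.aemeasurable hZ'.aemeasurable).1 hindep
  have : IsProbabilityMeasure (P.map fun ω x => Z x ω) :=
    Measure.isProbabilityMeasure_map hZ'.aemeasurable
  rw [← lintegral_map (f := F) (g := fun ω => (U ω, fun x => Z x ω)) hF (by fun_prop), h,
    lintegral_prod _ (by fun_prop), map_eq_restrict_halfOpenCube hUunif]
  refine lintegral_congr fun u => ?_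
  exact lintegral_map (f := fun ζ => F (u, ζ)) (by fun_prop) hZ'

/-- The displaced lattice is stationary. -/
lemma isStationaryMeasure_displacedLattice (hU : Measurable U)
    (hUunif : pdf.IsUniform U (unitCube d) P volume)
    (hZ : ∀ x, Measurable (Z x)) (hZstat : IsStationaryField P Z)
    (hindep : IndepFun U (fun ω x => Z x ω) P) :
    IsStationaryMeasure P (displacedLattice U Z) := by
  intro x
  let Γ : EuclideanSpace ℝ (Fin d) × ((Fin d → ℤ) → EuclideanSpace ℝ (Fin d)) →
      Measure (EuclideanSpace ℝ (Fin d)) := displacedLattice Prod.fst (fun x p => p.2 x)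
  have hΓ : Measurable Γ := measurable_displacedLattice measurable_fst fun x => by fun_prop
  have hΦ : displacedLattice U Z = fun ω => Γ (U ω, fun x => Z x ω) := rfl
  have hθ : (fun ω => shiftMeasure x (displacedLattice U Z ω)) =
      fun ω => Γ (U ω + -x, fun x => Z x ω) := by
    ext1 ω
    exact shiftMeasure_displacedLattice x (U ω) fun x => Z x ω
  have hZ' : Measurable fun ω x => Z x ω := measurable_pi_lambda _ hZ
  rw [hθ, hΦ]
  refine ⟨by fun_prop, by fun_prop, ?_⟩
  ext A hA
  have hA' : Measurable (A.indicator (1 : Measure (EuclideanSpace ℝ (Fin d)) → ℝ≥0∞)) :=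
    measurable_one.indicator hA
  rw [← lintegral_indicator_one hA, ← lintegral_indicator_one hA,
    lintegral_map hA' (by fun_prop), lintegral_map hA' (by fun_prop),
    lintegral_uniform_prod hU hUunif hZ hindep
      (F := fun p => A.indicator 1 (Γ (p.1 + -x, p.2))) (by fun_prop),
    lintegral_uniform_prod hU hUunif hZ hindep
      (F := fun p => A.indicator 1 (Γ p)) (by fun_prop)]
  -- The conditional probability of `A` given `U = u` is `ℤ^d`-periodic in `u`, so shifting `u` by
  -- `-x` does not change its integral over the cube.
  refine setLIntegral_halfOpenCube_add
    (h := fun u => ∫⁻ ω, A.indicator 1 (Γ (u, fun x => Z x ω)) ∂P) ?_ ?_ (-x)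
  · exact Measurable.lintegral_prod_right'
      (f := fun p : EuclideanSpace ℝ (Fin d) × Ω => A.indicator 1 (Γ (p.1, fun x => Z x p.2)))
      (by fun_prop)
  · intro z u
    rw [← hZstat.lintegral_comp_add (-z) (F := fun ζ => A.indicator 1 (Γ (u, ζ))) (by fun_prop)]
    refine lintegral_congr fun ω => ?_
    congr 1
    exact displacedLattice_latticePoint_add z u fun x => Z x ω

/-- Campbell's formula for the displaced lattice. -/
lemma lintegral_tsum_displaced (hU : Measurable U)
    (hUunif : pdf.IsUniform U (unitCube d) P volume)
    (hZ : ∀ x, Measurable (Z x)) (hZstat : IsStationaryField P Z)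
    (hindep : IndepFun U (fun ω x => Z x ω) P)
    {b : EuclideanSpace ℝ (Fin d) → ℝ≥0∞} (hb : Measurable b) :
    ∫⁻ ω, ∑' x : Fin d → ℤ, b (latticePoint x + U ω + Z x ω) ∂P = ∫⁻ t, b t := by
  rw [lintegral_uniform_prod hU hUunif hZ hindep
    (F := fun p => ∑' x : Fin d → ℤ, b (latticePoint x + p.1 + p.2 x)) (by fun_prop)]
  have h1 : ∀ u, ∫⁻ ω, ∑' x : Fin d → ℤ, b (latticePoint x + u + Z x ω) ∂P =
      ∫⁻ ω, ∑' x : Fin d → ℤ, b (latticePoint x + u + Z 0 ω) ∂P := by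
    intro u
    rw [lintegral_tsum fun x => by fun_prop, lintegral_tsum fun x => by fun_prop]
    refine tsum_congr fun x => ?_
    have := hZstat.lintegral_comp_add x (F := fun ζ => b (latticePoint x + u + ζ 0)) (by fun_prop)
    simpa using this
  simp_rw [h1]
  rw [lintegral_lintegral_swap (by fun_prop)]
  have h2 : ∀ ω, ∫⁻ u in halfOpenCube d, ∑' x : Fin d → ℤ, b (latticePoint x + u + Z 0 ω) =
      ∫⁻ t, b t := by
    intro ω
    rw [← lintegral_add_right_eq_self b (Z 0 ω),
      lintegral_eq_lintegral_tsum_latticePoint (f := fun t => b (t + Z 0 ω)) (by fun_prop)]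
  simp [h2]

/-- The second moment of a linear statistic of the displaced lattice. -/
lemma lintegral_tsum_displaced_sq (hU : Measurable U)
    (hUunif : pdf.IsUniform U (unitCube d) P volume)
    (hZ : ∀ x, Measurable (Z x)) (hZstat : IsStationaryField P Z)
    (hindep : IndepFun U (fun ω x => Z x ω) P)
    {b : EuclideanSpace ℝ (Fin d) → ℝ≥0∞} (hb : Measurable b) :
    ∫⁻ ω, (∑' x : Fin d → ℤ, b (latticePoint x + U ω + Z x ω)) ^ 2 ∂P =
      ∑' z : Fin d → ℤ, ∫⁻ ω, autocorrelation b (latticePoint z + (Z z ω - Z 0 ω)) ∂P := by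
  rw [lintegral_uniform_prod hU hUunif hZ hindep
    (F := fun p => (∑' x : Fin d → ℤ, b (latticePoint x + p.1 + p.2 x)) ^ 2) (by fun_prop)]
  -- Pairs of lattice points are grouped by their difference `z`.
  have h0 : ∀ a : (Fin d → ℤ) → ℝ≥0∞, (∑' x, a x) ^ 2 = ∑' z, ∑' x, a x * a (x + z) := by
    intro a
    rw [sq, ← ENNReal.tsum_mul_right, ENNReal.tsum_comm]
    refine tsum_congr fun x => ?_
    rw [ENNReal.tsum_mul_left, ← (Equiv.addLeft x).tsum_eq a]
    rfl
  -- Stationarity moves the pair `(Z x, Z (x + z))` to `(Z 0, Z z)`, so that the lattice sum over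
  -- `x` and the integral over `u` later unfold to an integral over `ℝ^d`.
  have h1 : ∀ u, ∫⁻ ω, (∑' x : Fin d → ℤ, b (latticePoint x + u + Z x ω)) ^ 2 ∂P =
      ∑' z : Fin d → ℤ, ∫⁻ ω, ∑' x : Fin d → ℤ, b (latticePoint x + u + Z 0 ω) *
        b (latticePoint x + u + (latticePoint z + Z z ω)) ∂P := by
    intro u
    simp_rw [h0]
    rw [lintegral_tsum fun x => by fun_prop]
    refine tsum_congr fun z => ?_
    rw [lintegral_tsum fun x => by fun_prop, lintegral_tsum fun x => by fun_prop]
    refine tsum_congr fun x => ?_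
    have := hZstat.lintegral_comp_add x (F := fun ζ => b (latticePoint x + u + ζ 0) *
        b (latticePoint x + u + (latticePoint z + ζ z))) (by fun_prop)
    rw [← this]
    refine lintegral_congr fun ω => ?_
    dsimp only
    rw [zero_add, latticePoint_add, add_comm x z]
    congr 2
    abel
  simp_rw [h1]
  rw [lintegral_tsum fun z => ?_]
  swap
  · exact (Measurable.lintegral_prod_right'
      (f := fun p : EuclideanSpace ℝ (Fin d) × Ω => ∑' x : Fin d → ℤ,
        b (latticePoint x + p.1 + Z 0 p.2) *
          b (latticePoint x + p.1 + (latticePoint z + Z z p.2))) (by fun_prop)).aemeasurable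
  refine tsum_congr fun z => ?_
  rw [lintegral_lintegral_swap (by fun_prop)]
  refine lintegral_congr fun ω => ?_
  rw [autocorrelation, ← lintegral_add_right_eq_self
      (fun t => b t * b (t + (latticePoint z + (Z z ω - Z 0 ω)))) (Z 0 ω),
    lintegral_eq_lintegral_tsum_latticePoint (by fun_prop)]
  refine lintegral_congr fun u => tsum_congr fun x => ?_
  congr 2
  abel

end DisplacedLattice

/-! ### Fourier analysis of the lattice variance -/

section Parseval

variable {d : ℕ}

@[fun_prop]
lemma measurable_latticePoint : Measurable (latticePoint (d := d)) := by
  unfold latticePoint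
  fun_prop

/-- The tiling identity as a measure-preserving map, which also serves complex-valued integrals. -/
lemma measurePreserving_latticePoint_add :
    MeasurePreserving (fun p : (Fin d → ℤ) × EuclideanSpace ℝ (Fin d) => latticePoint p.1 + p.2)
      (Measure.count.prod (volume.restrict (halfOpenCube d))) volume := by
  refine ⟨by fun_prop, ?_⟩
  ext B hB
  have hb : Measurable (B.indicator (1 : EuclideanSpace ℝ (Fin d) → ℝ≥0∞)) :=
    measurable_one.indicator hB
  rw [← lintegral_indicator_one hB, ← lintegral_indicator_one hB,
    lintegral_map hb (by fun_prop), lintegral_prod_symm _ (by fun_prop),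
    lintegral_eq_lintegral_tsum_latticePoint hb]
  simp_rw [lintegral_count]

lemma mFourier_neg_coe (n : Fin d → ℤ) (u : EuclideanSpace ℝ (Fin d)) :
    UnitAddTorus.mFourier (-n) (fun i => (u i : UnitAddCircle)) =
      Complex.exp (-(Complex.I *
        ((inner ℝ ((2 * Real.pi) • latticePoint n) u : ℝ) : ℂ))) := by
  simp only [UnitAddTorus.mFourier, ContinuousMap.coe_mk, fourier_coe_apply, Pi.neg_apply]
  rw [← Complex.exp_sum]
  congr 1
  simp only [PiLp.inner_apply, PiLp.smul_apply, latticePoint_apply, RCLike.inner_apply,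
    conj_trivial, smul_eq_mul, Complex.ofReal_sum, Finset.mul_sum, ← Finset.sum_neg_distrib]
  refine Finset.sum_congr rfl fun i _ => ?_
  push_cast
  ring

lemma exp_inner_latticePoint_add (n z : Fin d → ℤ) (u : EuclideanSpace ℝ (Fin d)) :
    Complex.exp (-(Complex.I *
        ((inner ℝ ((2 * Real.pi) • latticePoint n) (latticePoint z + u) : ℝ) : ℂ))) =
      Complex.exp (-(Complex.I *
        ((inner ℝ ((2 * Real.pi) • latticePoint n) u : ℝ) : ℂ))) := by
  rw [← mFourier_neg_coe, ← mFourier_neg_coe]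
  congr 1
  ext1 i
  simp only [PiLp.add_apply, latticePoint_apply, AddCircle.coe_add]
  rw [add_eq_right]
  simp

/-- Characters of frequency `2πn` are `ℤ^d`-periodic, so folding the integral onto the cube affects
the indicator alone. The right-hand side is a Fourier coefficient of the lattice count. -/
lemma fourierIndicator_latticePoint {B : Set (EuclideanSpace ℝ (Fin d))} (hB : MeasurableSet B)
    (hBb : Bornology.IsBounded B) (n : Fin d → ℤ) :
    fourierIndicator B ((2 * Real.pi) • latticePoint n) =
      ∫ u in halfOpenCube d, Complex.exp (-(Complex.I *
        ((inner ℝ ((2 * Real.pi) • latticePoint n) u : ℝ) : ℂ))) *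
        ((periodization (B.indicator 1) u).toReal : ℂ) := by
  set e : EuclideanSpace ℝ (Fin d) → ℂ := fun u => Complex.exp (-(Complex.I *
        ((inner ℝ ((2 * Real.pi) • latticePoint n) u : ℝ) : ℂ))) with he
  have hcont : Continuous e := by fun_prop
  have hnorm : ∀ u, ‖e u‖ = 1 := fun u => by
    simp [he, Complex.norm_exp]
  have hint : Integrable (B.indicator e) := by
    rw [integrable_indicator_iff hB]
    exact Measure.integrableOn_of_bounded (M := 1) hBb.measure_lt_top.ne
      hcont.aestronglyMeasurable (ae_of_all _ fun u => (hnorm u).le)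
  have hmp := measurePreserving_latticePoint_add (d := d)
  have hint' := hmp.integrable_comp_of_integrable hint
  have h1 : fourierIndicator B ((2 * Real.pi) • latticePoint n) = ∫ x, B.indicator e x :=
    (integral_indicator hB).symm
  have h3 : ∫ x, B.indicator e x = ∫ p, B.indicator e (latticePoint p.1 + p.2)
      ∂(Measure.count.prod (volume.restrict (halfOpenCube d))) := by
    conv_lhs => rw [← hmp.map_eq]
    exact integral_map hmp.aemeasurable (by rw [hmp.map_eq]; exact hint.aestronglyMeasurable)
  rw [h1, h3]
  refine (integral_prod_symm _ hint').trans ?_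
  refine integral_congr_ae (ae_of_all _ fun u => ?_)
  have h2 : ∀ z : Fin d → ℤ, B.indicator e (latticePoint z + u) =
      e u *
        ((B.indicator (1 : EuclideanSpace ℝ (Fin d) → ℝ≥0∞) (latticePoint z + u)).toReal : ℂ) := by
    intro z
    by_cases hz : latticePoint z + u ∈ B
    · simp only [hz, Set.indicator_of_mem, he, exp_inner_latticePoint_add]
      simp
    · simp [hz]
  simp only [Function.comp_apply, h2]
  rw [integral_const_mul, integral_complex_ofReal, integral_toReal, lintegral_count]
  · rfl
  · fun_prop
  · exact ae_of_all _ fun z => (Set.indicator_apply_le' (fun _ => le_rfl) fun _ => zero_le).trans_lt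
      ENNReal.one_lt_top

lemma setIntegral_pi_Ioc {F : Type*} [NormedAddCommGroup F] [NormedSpace ℝ F]
    (f : (Fin d → ℝ) → F) :
    ∫ x in {x : Fin d → ℝ | ∀ i, x i ∈ Set.Ioc ((0 : Fin d → ℝ) i) ((0 : Fin d → ℝ) i + 1)}, f x =
      ∫ u in halfOpenCube d, f u.ofLp := by
  have h := (PiLp.volume_preserving_ofLp (Fin d)).setIntegral_preimage_emb
    (MeasurableEquiv.toLp 2 (Fin d → ℝ)).symm.measurableEmbedding f
    {x : Fin d → ℝ | ∀ i, x i ∈ Set.Ioc ((0 : Fin d → ℝ) i) ((0 : Fin d → ℝ) i + 1)}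
  rw [← h]
  congr 2
  ext u
  simp [halfOpenCube]

section Torus

attribute [local instance] instMeasureSpaceUnitAddCircle

/-- Parseval's identity for the number of points of a uniformly translated lattice in `B`. -/
lemma hasSum_sq_fourierIndicator {B : Set (EuclideanSpace ℝ (Fin d))} (hB : MeasurableSet B)
    (hBb : Bornology.IsBounded B) :
    HasSum (fun n : Fin d → ℤ => ‖fourierIndicator B ((2 * Real.pi) • latticePoint n)‖ ^ 2)
      (∫⁻ u in halfOpenCube d, periodization (B.indicator 1) u ^ 2).toReal := by
  obtain ⟨K, hK⟩ := exists_periodization_indicator_le hBb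
  have hb : Measurable (B.indicator (1 : EuclideanSpace ℝ (Fin d) → ℝ≥0∞)) :=
    measurable_one.indicator hB
  -- The lattice count as a function on the torus, read through representatives in `(0, 1]^d`;
  -- boundedness puts it in `L²`.
  let F : UnitAddTorus (Fin d) → ℂ := fun t =>
    ((periodization (B.indicator 1)
      (WithLp.toLp 2 (UnitAddTorus.measurableEquivPiIoc 0 t).1)).toReal : ℂ)
  have hFm : Measurable F := by fun_prop
  have hFle : ∀ t, ‖F t‖ ≤ K := by
    intro t
    have hmem : WithLp.toLp 2 (UnitAddTorus.measurableEquivPiIoc 0 t).1 ∈ halfOpenCube d := by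
      intro i
      simpa using (UnitAddTorus.measurableEquivPiIoc 0 t).2 i
    simp only [F, Complex.norm_real, Real.norm_eq_abs, abs_of_nonneg ENNReal.toReal_nonneg]
    exact ENNReal.toReal_le_of_le_ofReal (by positivity) (by simpa using hK _ hmem)
  have : IsProbabilityMeasure (volume : Measure UnitAddCircle) :=
    inferInstanceAs (IsProbabilityMeasure AddCircle.haarAddCircle)
  have hFlp : MemLp F 2 volume :=
    MemLp.of_bound hFm.aestronglyMeasurable K (ae_of_all _ hFle)
  have hFcoe : ∀ u ∈ halfOpenCube d, F (fun i => (u i : UnitAddCircle)) =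
      ((periodization (B.indicator 1) u).toReal : ℂ) := by
    intro u hu
    have := (UnitAddTorus.measurableEquivPiIoc (0 : Fin d → ℝ)).apply_symm_apply
      ⟨u.ofLp, fun i => by simpa using hu i⟩
    rw [UnitAddTorus.coe_symm_measurableEquivPiIoc_apply] at this
    simp only [F, this]
  have hcoeff : ∀ n, UnitAddTorus.mFourierCoeff (hFlp.toLp F) n =
      fourierIndicator B ((2 * Real.pi) • latticePoint n) := by
    intro n
    have h1 : UnitAddTorus.mFourierCoeff (hFlp.toLp F) n = UnitAddTorus.mFourierCoeff F n :=
      integral_congr_ae (hFlp.coeFn_toLp.mono fun t ht => congrArg (_ • ·) ht)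
    rw [h1, UnitAddTorus.mFourierCoeff_eq_integral F n 0, setIntegral_pi_Ioc,
      fourierIndicator_latticePoint hB hBb]
    refine setIntegral_congr_fun measurableSet_halfOpenCube fun u hu => ?_
    simp only [hFcoe u hu, mFourier_neg_coe, smul_eq_mul]
  have hsq : ∫ t, ‖hFlp.toLp F t‖ ^ 2 =
      (∫⁻ u in halfOpenCube d, periodization (B.indicator 1) u ^ 2).toReal := by
    have h1 : ∫ t, ‖hFlp.toLp F t‖ ^ 2 = ∫ t, ‖F t‖ ^ 2 :=
      integral_congr_ae (hFlp.coeFn_toLp.mono fun t ht => by simp only [ht])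
    rw [h1, UnitAddTorus.integral_preimage (fun t => ‖F t‖ ^ 2) 0, setIntegral_pi_Ioc,
      ← integral_toReal]
    · refine setIntegral_congr_fun measurableSet_halfOpenCube fun u hu => ?_
      simp [hFcoe u hu]
    · fun_prop
    · refine (ae_restrict_mem measurableSet_halfOpenCube).mono fun u hu => ?_
      exact ENNReal.pow_lt_top ((hK u hu).trans_lt (ENNReal.natCast_lt_top K))
  rw [← hsq]
  simpa only [hcoeff] using UnitAddTorus.hasSum_sq_mFourierCoeff (hFlp.toLp F)

end Torus

lemma fourierIndicator_zero (B : Set (EuclideanSpace ℝ (Fin d))) :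
    fourierIndicator B 0 = ((volume B).toReal : ℂ) := by
  simp [fourierIndicator, Measure.real]

lemma fourierIndicator_smul {r : ℝ} (hr : 0 < r) (B : Set (EuclideanSpace ℝ (Fin d)))
    (k : EuclideanSpace ℝ (Fin d)) :
    fourierIndicator (r • B) k = (r : ℂ) ^ d * fourierIndicator B (r • k) := by
  have h := Measure.setIntegral_comp_smul_of_pos volume
    (fun x : EuclideanSpace ℝ (Fin d) => Complex.exp (-(Complex.I * ((inner ℝ k x : ℝ) : ℂ)))) B hr
  unfold fourierIndicator
  simp only [inner_smul_left, conj_trivial, inner_smul_right, finrank_euclideanSpace,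
    Fintype.card_fin] at h ⊢
  have hr' : (r : ℂ) ^ d ≠ 0 := pow_ne_zero _ (Complex.ofReal_ne_zero.2 hr.ne')
  rw [h, Complex.real_smul, ← mul_assoc]
  push_cast
  rw [mul_inv_cancel₀ hr', one_mul]

/-- The integer points lie in the `ℤ`-span of the standard basis, a lattice of rank `d`, for which
powers of the norm below `-d` are summable. -/
lemma summable_norm_latticePoint_rpow {s : ℝ} (hs : s < -(d : ℝ)) :
    Summable fun n : Fin d → ℤ => ‖latticePoint n‖ ^ s := by
  obtain ⟨L, hmem, h⟩ : ∃ L : Submodule ℤ (EuclideanSpace ℝ (Fin d)),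
      (∀ n : Fin d → ℤ, latticePoint n ∈ L) ∧
        Summable fun z : L => ‖(z : EuclideanSpace ℝ (Fin d))‖ ^ s := by
    obtain ⟨b, hb⟩ : ∃ b : Module.Basis (Fin d) ℝ (EuclideanSpace ℝ (Fin d)),
        ∀ i j, b i j = if i = j then 1 else 0 :=
      ⟨(EuclideanSpace.basisFun (Fin d) ℝ).toBasis, fun i j => by simp [eq_comm]⟩
    refine ⟨Submodule.span ℤ (Set.range b), fun n => ?_, ?_⟩
    · have : latticePoint n = ∑ i, n i • b i := by
        ext j
        simp [hb]
      rw [this]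
      exact Submodule.sum_mem _ fun i _ =>
        Submodule.smul_mem _ _ (Submodule.subset_span (Set.mem_range_self i))
    · refine ZLattice.summable_norm_rpow _ s ?_
      rwa [ZLattice.rank ℝ, finrank_euclideanSpace, Fintype.card_fin]
  have hinj : Function.Injective fun n : Fin d → ℤ => (⟨latticePoint n, hmem n⟩ : L) := by
    intro m n hmn
    ext i
    have h0 : latticePoint m i = latticePoint n i :=
      congrArg (fun x : L => (x : EuclideanSpace ℝ (Fin d)) i) hmn
    simpa using h0
  have h' := h.comp_injective hinj
  simpa only [Function.comp_def] using h'

/-- The variance of the number of points of a uniformly translated lattice in `rW`, divided by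
`r^d`, tends to `0` if `W` is Fourier smooth. -/
lemma exists_lattice_variance_le {W : Set (EuclideanSpace ℝ (Fin d))} (hW : IsFourierSmooth W) :
    ∃ C θ : ℝ, 0 < θ ∧ ∀ r : ℝ, 0 < r →
      (∫⁻ u in halfOpenCube d, periodization ((r • W).indicator 1) u ^ 2).toReal -
        (volume (r • W)).toReal ^ 2 ≤ C * r ^ ((d : ℝ) - θ) := by
  obtain ⟨hWm, hWb, c, θ, hc, hθ, hbound⟩ := hW
  -- Scaling contributes `r^(2d)` and the squared decay at `2πrn` at most `c² (r‖n‖)^(-(d+θ))`,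
  -- hence the factor `r^(d-θ)`.
  let S : (Fin d → ℤ) → ℝ := fun n => c ^ 2 * ‖latticePoint n‖ ^ (-((d : ℝ) + θ))
  have hS : Summable S := (summable_norm_latticePoint_rpow (by linarith)).mul_left _
  refine ⟨∑' n, S n, θ, hθ, fun r hr => ?_⟩
  have hsum := hasSum_sq_fourierIndicator (hWm.const_smul₀ r) (hWb.smul₀ r)
  -- The term `n = 0` is the squared mean `λ(rW)²`.
  have hsub := hasSum_ite_sub_hasSum hsum (0 : Fin d → ℤ)
  rw [latticePoint_zero, smul_zero, fourierIndicator_zero, Complex.norm_real, Real.norm_eq_abs, sq_abs]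
    at hsub
  have hneg : -((d : ℝ) + θ) ≤ 0 := by linarith [d.cast_nonneg (α := ℝ)]
  refine hasSum_le (fun n => ?_) hsub (hS.hasSum.mul_right _)
  split_ifs with hn
  · positivity
  have hn' : 0 < ‖latticePoint n‖ := by
    rw [norm_pos_iff]
    contrapose! hn
    ext i
    have := congrArg (fun x : EuclideanSpace ℝ (Fin d) => x i) hn
    simpa using this
  have hle : r * ‖latticePoint n‖ ≤ 1 + ‖r • (2 * Real.pi) • latticePoint n‖ := by
    rw [norm_smul, norm_smul, Real.norm_of_nonneg hr.le,
      Real.norm_of_nonneg (by positivity : (0 : ℝ) ≤ 2 * Real.pi)]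
    have h1 : 1 ≤ 2 * Real.pi := by linarith [Real.pi_gt_three]
    have h2 : 0 < r * ‖latticePoint n‖ := by positivity
    nlinarith
  rw [fourierIndicator_smul hr, norm_mul, norm_pow, Complex.norm_real, Real.norm_of_nonneg hr.le,
    mul_pow]
  calc (r ^ d) ^ 2 * ‖fourierIndicator W (r • (2 * Real.pi) • latticePoint n)‖ ^ 2
      ≤ (r ^ d) ^ 2 *
          (c * (1 + ‖r • (2 * Real.pi) • latticePoint n‖) ^ (-((d : ℝ) + θ) / 2)) ^ 2 := by
        gcongr
        exact hbound _
    _ = (r ^ d) ^ 2 * (c ^ 2 * (1 + ‖r • (2 * Real.pi) • latticePoint n‖) ^ (-((d : ℝ) + θ))) := by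
        rw [mul_pow, ← Real.rpow_mul_natCast (by positivity)]
        congr 3
        push_cast
        ring
    _ ≤ (r ^ d) ^ 2 * (c ^ 2 * (r * ‖latticePoint n‖) ^ (-((d : ℝ) + θ))) := by
        gcongr ?_ * (?_ * ?_)
        exact Real.rpow_le_rpow_of_nonpos (by positivity) hle hneg
    _ = S n * r ^ ((d : ℝ) - θ) := by
        rw [Real.mul_rpow hr.le hn'.le,
          show (d : ℝ) - θ = ((d * 2 : ℕ) : ℝ) + (-((d : ℝ) + θ)) by push_cast; ring,
          Real.rpow_add hr, Real.rpow_natCast, pow_mul]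
        simp only [S]
        ring

end Parseval

/-! ### Test functions for the total variation norm -/

section TotalVariation

lemma ofReal_abs_integral_sub_le_tvNormSub {S : Type*} [MeasurableSpace S] (μ ν : Measure S)
    {f : S → ℝ} (hf : Measurable f) (hf1 : ∀ s, f s ∈ Set.Icc (-1 : ℝ) 1) :
    ENNReal.ofReal |∫ s, f s ∂μ - ∫ s, f s ∂ν| ≤ tvNormSub μ ν := by
  unfold tvNormSub
  exact le_iSup_of_le f (le_iSup_of_le hf (le_iSup_of_le hf1 le_rfl))

end TotalVariation

/-! ### The normalized covariogram of a window -/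

section Covariogram

variable {d : ℕ}

/-- The normalized covariogram `w ↦ λ(B ∩ (B - w)) / λ(B)` of a set `B`. -/
noncomputable def covariogram (B : Set (EuclideanSpace ℝ (Fin d)))
    (w : EuclideanSpace ℝ (Fin d)) : ℝ :=
  (autocorrelation (B.indicator 1) w).toReal / (volume B).toReal

lemma autocorrelation_indicator_le {B : Set (EuclideanSpace ℝ (Fin d))} (hB : MeasurableSet B)
    (w : EuclideanSpace ℝ (Fin d)) :
    autocorrelation (B.indicator 1) w ≤ volume B := by
  rw [autocorrelation, ← lintegral_indicator_one hB]
  refine lintegral_mono fun t => mul_le_of_le_one_right zero_le ?_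
  exact Set.indicator_apply_le' (fun _ => le_rfl) fun _ => zero_le

lemma le_autocorrelation_indicator {A B : Set (EuclideanSpace ℝ (Fin d))}
    {w : EuclideanSpace ℝ (Fin d)} (hA : MeasurableSet A) (hAB : A ⊆ B)
    (hw : ∀ t ∈ A, t + w ∈ B) :
    volume A ≤ autocorrelation (B.indicator 1) w := by
  rw [autocorrelation, ← lintegral_indicator_one hA]
  refine lintegral_mono fun t => Set.indicator_apply_le' (fun ht => ?_) fun _ => zero_le
  simp [hAB ht, hw t ht]

lemma measurable_covariogram {B : Set (EuclideanSpace ℝ (Fin d))} (hB : MeasurableSet B) :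
    Measurable (covariogram B) := by
  have hb : Measurable (B.indicator (1 : EuclideanSpace ℝ (Fin d) → ℝ≥0∞)) :=
    measurable_one.indicator hB
  unfold covariogram
  fun_prop

lemma covariogram_nonneg (B : Set (EuclideanSpace ℝ (Fin d))) (w : EuclideanSpace ℝ (Fin d)) :
    0 ≤ covariogram B w := by
  unfold covariogram
  positivity

lemma covariogram_le_one {B : Set (EuclideanSpace ℝ (Fin d))} (hB : MeasurableSet B)
    (hBb : Bornology.IsBounded B) (w : EuclideanSpace ℝ (Fin d)) : covariogram B w ≤ 1 :=
  div_le_one_of_le₀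
    (ENNReal.toReal_mono hBb.measure_lt_top.ne (autocorrelation_indicator_le hB w))
    ENNReal.toReal_nonneg

lemma autocorrelation_eq_mul_covariogram {B : Set (EuclideanSpace ℝ (Fin d))}
    (hB : MeasurableSet B) (hBb : Bornology.IsBounded B) (w : EuclideanSpace ℝ (Fin d)) :
    autocorrelation (B.indicator 1) w = volume B * ENNReal.ofReal (covariogram B w) := by
  have hle := autocorrelation_indicator_le hB w
  have hV := hBb.measure_lt_top (μ := volume)
  -- For a null set both sides vanish, so the value of `0 / 0` is immaterial.
  rcases eq_or_ne (volume B) 0 with h0 | h0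
  · rw [h0] at hle ⊢
    simpa using hle
  · rw [← ENNReal.ofReal_toReal hV.ne, ← ENNReal.ofReal_mul ENNReal.toReal_nonneg, covariogram,
      mul_div_cancel₀ _ (ENNReal.toReal_ne_zero.2 ⟨h0, hV.ne⟩),
      ENNReal.ofReal_toReal (hle.trans_lt hV).ne]

lemma integrable_covariogram {S : Type*} [MeasurableSpace S] (μ : Measure S) [IsFiniteMeasure μ]
    {B : Set (EuclideanSpace ℝ (Fin d))} (hB : MeasurableSet B) (hBb : Bornology.IsBounded B)
    {h : S → EuclideanSpace ℝ (Fin d)} (hh : Measurable h) :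
    Integrable (fun s => covariogram B (h s)) μ :=
  Integrable.of_bound ((measurable_covariogram hB).comp hh).aestronglyMeasurable 1
    (ae_of_all _ fun s => by
      rw [Real.norm_of_nonneg (covariogram_nonneg _ _)]; exact covariogram_le_one hB hBb _)

lemma lintegral_autocorrelation {S : Type*} [MeasurableSpace S] (μ : Measure S)
    [IsFiniteMeasure μ] {B : Set (EuclideanSpace ℝ (Fin d))} (hB : MeasurableSet B)
    (hBb : Bornology.IsBounded B) {h : S → EuclideanSpace ℝ (Fin d)} (hh : Measurable h) :
    ∫⁻ s, autocorrelation (B.indicator 1) (h s) ∂μ =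
      volume B * ENNReal.ofReal (∫ s, covariogram B (h s) ∂μ) := by
  simp_rw [autocorrelation_eq_mul_covariogram hB hBb]
  have hm := (measurable_covariogram hB).comp hh
  rw [lintegral_const_mul _ (f := fun s => ENNReal.ofReal (covariogram B (h s))) hm.ennreal_ofReal,
    ofReal_integral_eq_lintegral_ofReal (integrable_covariogram μ hB hBb hh)
      (ae_of_all _ fun s => covariogram_nonneg _ _)]

lemma volume_smul_toReal {r : ℝ} (hr : 0 ≤ r) (W : Set (EuclideanSpace ℝ (Fin d))) :
    (volume (r • W)).toReal = r ^ d * (volume W).toReal := by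
  rw [Measure.addHaar_smul_of_nonneg _ hr, ENNReal.toReal_mul, finrank_euclideanSpace,
    Fintype.card_fin, ENNReal.toReal_ofReal (by positivity)]

lemma IsConvexWindow.volume_toReal_pos {W : Set (EuclideanSpace ℝ (Fin d))}
    (hW : IsConvexWindow W) : 0 < (volume W).toReal :=
  ENNReal.toReal_pos
    (ne_of_gt ((isOpen_interior.measure_pos volume ⟨0, hW.2.2⟩).trans_le
      (measure_mono interior_subset))) hW.2.1.measure_lt_top.ne

/-- The normalized covariogram of a growing convex window tends to `1`. -/
lemma tendsto_covariogram_smul {W : Set (EuclideanSpace ℝ (Fin d))} (hW : IsConvexWindow W)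
    (hWm : MeasurableSet W) (w : EuclideanSpace ℝ (Fin d)) :
    Tendsto (fun r : ℝ => covariogram (r • W) w) atTop (𝓝 1) := by
  have hV := hW.volume_toReal_pos
  obtain ⟨hconv, hbd, h0⟩ := hW
  have h0W : (0 : EuclideanSpace ℝ (Fin d)) ∈ W := interior_subset h0
  -- Since `0` is interior, `W` absorbs `w`. Convexity gives `rW = (r - s)W + sW`, so translation by
  -- `w` maps `(r - s)W` into `rW` and the covariogram is at least `(1 - s/r)^d`.
  obtain ⟨s, hs, hws⟩ : ∃ s : ℝ, 0 < s ∧ w ∈ s • W := by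
    have ht : Tendsto (fun s : ℝ => s⁻¹ • w) atTop (𝓝 0) := by
      simpa using (tendsto_inv_atTop_zero (𝕜 := ℝ)).smul_const w
    obtain ⟨s, hs, hs0⟩ :=
      ((ht.eventually (mem_interior_iff_mem_nhds.1 h0)).and (eventually_gt_atTop 0)).exists
    exact ⟨s, hs0, (Set.mem_smul_set_iff_inv_smul_mem₀ hs0.ne' _ _).2 hs⟩
  have hlim : Tendsto (fun r : ℝ => (1 - s * r⁻¹) ^ d) atTop (𝓝 1) := by
    simpa using ((tendsto_inv_atTop_zero.const_mul s).const_sub 1).pow d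
  refine tendsto_of_tendsto_of_tendsto_of_le_of_le' hlim tendsto_const_nhds ?_
    (Eventually.of_forall fun r => covariogram_le_one (hWm.const_smul₀ r) (hbd.smul₀ r) w)
  filter_upwards [eventually_gt_atTop s] with r hr
  have hr0 : 0 < r := hs.trans hr
  have hsplit : r • W = (r - s) • W + s • W := by
    rw [← hconv.add_smul (by linarith) hs.le, sub_add_cancel]
  have hsub : volume ((r - s) • W) ≤ autocorrelation ((r • W).indicator 1) w := by
    refine le_autocorrelation_indicator (hWm.const_smul₀ _) (fun t ht => ?_) fun t ht => ?_
    · rw [hsplit, ← add_zero t]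
      exact Set.add_mem_add ht ⟨0, h0W, smul_zero _⟩
    · rw [hsplit]
      exact Set.add_mem_add ht hws
  have hfin : autocorrelation ((r • W).indicator 1) w ≠ ∞ :=
    ((autocorrelation_indicator_le (hWm.const_smul₀ r) w).trans_lt
      (hbd.smul₀ r).measure_lt_top).ne
  have h1 := ENNReal.toReal_mono hfin hsub
  rw [volume_smul_toReal (by linarith)] at h1
  rw [covariogram, volume_smul_toReal hr0.le, le_div_iff₀ (by positivity)]
  calc (1 - s * r⁻¹) ^ d * (r ^ d * (volume W).toReal)
      = ((1 - s * r⁻¹) * r) ^ d * (volume W).toReal := by rw [mul_pow]; ring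
    _ = (r - s) ^ d * (volume W).toReal := by
        congr 2
        field_simp
    _ ≤ _ := h1

end Covariogram

/-! ### Decoupling, variance bound and hyperuniformity -/

section SecondMoment

variable {d : ℕ} {Ω : Type*} [MeasurableSpace Ω] {P : Measure Ω}
  {U : Ω → EuclideanSpace ℝ (Fin d)} {Z : (Fin d → ℤ) → Ω → EuclideanSpace ℝ (Fin d)}

/-- The effect on the covariogram of `B` of replacing `(Z z, Z 0)` by an independent pair with
the same marginals. -/
noncomputable def decouplingError (P : Measure Ω)
    (Z : (Fin d → ℤ) → Ω → EuclideanSpace ℝ (Fin d)) (B : Set (EuclideanSpace ℝ (Fin d)))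
    (z : Fin d → ℤ) : ℝ :=
  |∫ p, covariogram B (latticePoint z + (p.1 - p.2)) ∂(P.map fun ω => (Z z ω, Z 0 ω)) -
    ∫ p, covariogram B (latticePoint z + (p.1 - p.2)) ∂((P.map (Z 0)).prod (P.map (Z 0)))|

lemma decouplingError_nonneg (B : Set (EuclideanSpace ℝ (Fin d))) (z : Fin d → ℤ) :
    0 ≤ decouplingError P Z B z :=
  abs_nonneg _

/-- The normalized covariogram takes values in `[0, 1]`, hence is an admissible test function. The
bound does not involve `B`, so it dominates all windows `rW` at once. -/
lemma ofReal_decouplingError_le {B : Set (EuclideanSpace ℝ (Fin d))} (hB : MeasurableSet B)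
    (hBb : Bornology.IsBounded B) (z : Fin d → ℤ) :
    ENNReal.ofReal (decouplingError P Z B z) ≤
      tvNormSub (P.map fun ω => (Z z ω, Z 0 ω)) ((P.map (Z 0)).prod (P.map (Z 0))) :=
  ofReal_abs_integral_sub_le_tvNormSub _ _ ((measurable_covariogram hB).comp (by fun_prop))
    fun _ => ⟨neg_one_lt_zero.le.trans (covariogram_nonneg _ _), covariogram_le_one hB hBb _⟩

variable [IsProbabilityMeasure P]

/-- Under either law the covariogram tends to `1` at every point and stays in `[0, 1]`, so both
integrals tend to `1`. -/
lemma tendsto_decouplingError (hZ : ∀ x, Measurable (Z x))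
    {W : Set (EuclideanSpace ℝ (Fin d))} (hW : IsConvexWindow W) (hWm : MeasurableSet W)
    (z : Fin d → ℤ) :
    Tendsto (fun r : ℝ => decouplingError P Z (r • W) z) atTop (𝓝 0) := by
  have hprob0 : IsProbabilityMeasure (P.map (Z 0)) :=
    Measure.isProbabilityMeasure_map (hZ 0).aemeasurable
  have hprobz : IsProbabilityMeasure (P.map fun ω => (Z z ω, Z 0 ω)) :=
    Measure.isProbabilityMeasure_map (by fun_prop)
  have key : ∀ μ : Measure (EuclideanSpace ℝ (Fin d) × EuclideanSpace ℝ (Fin d)),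
      IsProbabilityMeasure μ → Tendsto (fun r : ℝ =>
        ∫ p, covariogram (r • W) (latticePoint z + (p.1 - p.2)) ∂μ) atTop (𝓝 1) := by
    intro μ hμ
    have h1 : (1 : ℝ) = ∫ _p, (1 : ℝ) ∂μ := by simp
    rw [h1]
    refine tendsto_integral_filter_of_dominated_convergence (fun _ => 1)
      (Eventually.of_forall fun r => (integrable_covariogram μ (hWm.const_smul₀ r)
        (hW.2.1.smul₀ r) (by fun_prop)).aestronglyMeasurable)
      (Eventually.of_forall fun r => ae_of_all _ fun p => ?_) (integrable_const _)
      (ae_of_all _ fun p => tendsto_covariogram_smul hW hWm _)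
    rw [Real.norm_of_nonneg (covariogram_nonneg _ _)]
    exact covariogram_le_one (hWm.const_smul₀ r) (hW.2.1.smul₀ r) _
  simpa [decouplingError] using ((key _ hprobz).sub (key _ inferInstance)).abs

/-- The second moment of the number of points of the displaced lattice in `B` exceeds that of the
undisplaced lattice at most by the total decoupling error. -/
lemma lintegral_displacedLattice_sq_le (hU : Measurable U)
    (hUunif : pdf.IsUniform U (unitCube d) P volume)
    (hZ : ∀ x, Measurable (Z x)) (hZstat : IsStationaryField P Z)
    (hindep : IndepFun U (fun ω x => Z x ω) P)
    {B : Set (EuclideanSpace ℝ (Fin d))} (hB : MeasurableSet B) (hBb : Bornology.IsBounded B) :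
    ∫⁻ ω, (displacedLattice U Z ω B) ^ 2 ∂P ≤
      (∫⁻ u in halfOpenCube d, periodization (B.indicator 1) u ^ 2) +
        volume B * ∑' z, ENNReal.ofReal (decouplingError P Z B z) := by
  have hb : Measurable (B.indicator (1 : EuclideanSpace ℝ (Fin d) → ℝ≥0∞)) :=
    measurable_one.indicator hB
  have hprob0 : IsProbabilityMeasure (P.map (Z 0)) :=
    Measure.isProbabilityMeasure_map (hZ 0).aemeasurable
  simp_rw [displacedLattice_apply U Z _ hB]
  rw [lintegral_tsum_displaced_sq hU hUunif hZ hZstat hindep hb]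
  have hterm : ∀ z, ∫⁻ ω, autocorrelation (B.indicator 1) (latticePoint z + (Z z ω - Z 0 ω)) ∂P ≤
      ∫⁻ p, autocorrelation (B.indicator 1) (latticePoint z + (p.1 - p.2))
        ∂((P.map (Z 0)).prod (P.map (Z 0))) +
      volume B * ENNReal.ofReal (decouplingError P Z B z) := by
    intro z
    have hprobz : IsProbabilityMeasure (P.map fun ω => (Z z ω, Z 0 ω)) :=
      Measure.isProbabilityMeasure_map (by fun_prop)
    rw [← lintegral_map (μ := P) (g := fun ω => (Z z ω, Z 0 ω))
      (f := fun p => autocorrelation (B.indicator 1) (latticePoint z + (p.1 - p.2)))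
      (by fun_prop) (by fun_prop), lintegral_autocorrelation _ hB hBb (by fun_prop),
      lintegral_autocorrelation _ hB hBb (by fun_prop), ← mul_add,
      ← ENNReal.ofReal_add (integral_nonneg fun p => covariogram_nonneg _ _)
        (decouplingError_nonneg _ _)]
    gcongr
    have h := le_abs_self
      (∫ p, covariogram B (latticePoint z + (p.1 - p.2)) ∂(P.map fun ω => (Z z ω, Z 0 ω)) -
        ∫ p, covariogram B (latticePoint z + (p.1 - p.2)) ∂((P.map (Z 0)).prod (P.map (Z 0))))
    rw [decouplingError]
    linarith
  refine (ENNReal.tsum_le_tsum hterm).trans ?_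
  rw [ENNReal.tsum_add, ENNReal.tsum_mul_left]
  gcongr
  -- The product law is the same for all `z`, so the sum goes inside the integral and is bounded for
  -- each fixed `p`.
  rw [← lintegral_tsum fun z => by fun_prop]
  calc _ ≤ ∫⁻ _p : EuclideanSpace ℝ (Fin d) × EuclideanSpace ℝ (Fin d),
        (∫⁻ u in halfOpenCube d, periodization (B.indicator 1) u ^ 2)
          ∂((P.map (Z 0)).prod (P.map (Z 0))) :=
        lintegral_mono fun p => tsum_autocorrelation_le hb _
    _ = _ := by simp

lemma isLocallySquareIntegrable_displacedLattice (hU : Measurable U)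
    (hUunif : pdf.IsUniform U (unitCube d) P volume)
    (hZ : ∀ x, Measurable (Z x)) (hZstat : IsStationaryField P Z)
    (hindep : IndepFun U (fun ω x => Z x ω) P)
    (hmix : ∑' y : Fin d → ℤ,
      tvNormSub (P.map (fun ω => (Z y ω, Z 0 ω))) ((P.map (Z 0)).prod (P.map (Z 0))) < ∞) :
    IsLocallySquareIntegrable P (displacedLattice U Z) := by
  intro B hB hBb
  refine (lintegral_displacedLattice_sq_le hU hUunif hZ hZstat hindep hB hBb).trans_lt ?_
  refine ENNReal.add_lt_top.2 ⟨setLIntegral_periodization_indicator_sq_lt_top hBb,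
    ENNReal.mul_lt_top hBb.measure_lt_top ?_⟩
  exact (ENNReal.tsum_le_tsum fun z => ofReal_decouplingError_le hB hBb z).trans_lt hmix

lemma lintegral_displacedLattice_apply (hU : Measurable U)
    (hUunif : pdf.IsUniform U (unitCube d) P volume)
    (hZ : ∀ x, Measurable (Z x)) (hZstat : IsStationaryField P Z)
    (hindep : IndepFun U (fun ω x => Z x ω) P)
    {B : Set (EuclideanSpace ℝ (Fin d))} (hB : MeasurableSet B) :
    ∫⁻ ω, displacedLattice U Z ω B ∂P = volume B := by
  simp_rw [displacedLattice_apply U Z _ hB]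
  rw [lintegral_tsum_displaced hU hUunif hZ hZstat hindep (measurable_one.indicator hB),
    lintegral_indicator_one hB]

lemma ae_displacedLattice_apply_lt_top (hU : Measurable U)
    (hUunif : pdf.IsUniform U (unitCube d) P volume)
    (hZ : ∀ x, Measurable (Z x)) (hZstat : IsStationaryField P Z)
    (hindep : IndepFun U (fun ω x => Z x ω) P)
    {B : Set (EuclideanSpace ℝ (Fin d))} (hB : MeasurableSet B) (hBb : Bornology.IsBounded B) :
    ∀ᵐ ω ∂P, displacedLattice U Z ω B < ∞ := by
  refine ae_lt_top ((Measure.measurable_coe hB).comp (measurable_displacedLattice hU hZ)) ?_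
  rw [lintegral_displacedLattice_apply hU hUunif hZ hZstat hindep hB]
  exact hBb.measure_lt_top.ne

lemma isPointProcess_displacedLattice (hU : Measurable U)
    (hUunif : pdf.IsUniform U (unitCube d) P volume)
    (hZ : ∀ x, Measurable (Z x)) (hZstat : IsStationaryField P Z)
    (hindep : IndepFun U (fun ω x => Z x ω) P) :
    IsPointProcess P (displacedLattice U Z) := by
  refine ⟨measurable_displacedLattice hU hZ, ?_⟩
  -- Finite intensity makes each count finite almost surely; countably many balls suffice for local
  -- finiteness.
  have h : ∀ᵐ ω ∂P, ∀ n : ℕ, displacedLattice U Z ω (Metric.ball 0 n) < ∞ :=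
    ae_all_iff.2 fun n => ae_displacedLattice_apply_lt_top hU hUunif hZ hZstat hindep
      measurableSet_ball Metric.isBounded_ball
  filter_upwards [h] with ω hω
  refine ⟨⟨fun x => ?_⟩, fun B hB => exists_displacedLattice_apply_eq U Z ω hB⟩
  obtain ⟨n, hn⟩ := exists_nat_gt ‖x‖
  exact ⟨Metric.ball 0 n, Metric.isOpen_ball.mem_nhds (by simpa using hn), hω n⟩

/-- Displacement preserves the mean `λ(B)`, so the second moment bound becomes a variance bound
whose first two terms are the variance of the undisplaced lattice count. -/
lemma variance_displacedLattice_le (hU : Measurable U)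
    (hUunif : pdf.IsUniform U (unitCube d) P volume)
    (hZ : ∀ x, Measurable (Z x)) (hZstat : IsStationaryField P Z)
    (hindep : IndepFun U (fun ω x => Z x ω) P)
    {B : Set (EuclideanSpace ℝ (Fin d))} (hB : MeasurableSet B) (hBb : Bornology.IsBounded B)
    (hsum : Summable (decouplingError P Z B)) :
    variance (fun ω => (displacedLattice U Z ω B).toReal) P ≤
      (∫⁻ u in halfOpenCube d, periodization (B.indicator 1) u ^ 2).toReal -
        (volume B).toReal ^ 2 + (volume B).toReal * ∑' z, decouplingError P Z B z := by
  have hmeas : Measurable fun ω => displacedLattice U Z ω B :=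
    (Measure.measurable_coe hB).comp (measurable_displacedLattice hU hZ)
  have hfin := ae_displacedLattice_apply_lt_top hU hUunif hZ hZstat hindep hB hBb
  have hM := setLIntegral_periodization_indicator_sq_lt_top hBb
  have hV := hBb.measure_lt_top (μ := volume)
  have hle := lintegral_displacedLattice_sq_le hU hUunif hZ hZstat hindep hB hBb
  have herr : ∀ z, 0 ≤ decouplingError P Z B z := decouplingError_nonneg B
  rw [← ENNReal.ofReal_tsum_of_nonneg herr hsum] at hle
  have htop : (∫⁻ u in halfOpenCube d, periodization (B.indicator 1) u ^ 2) +
      volume B * ENNReal.ofReal (∑' z, decouplingError P Z B z) < ∞ :=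
    ENNReal.add_lt_top.2 ⟨hM, ENNReal.mul_lt_top hV ENNReal.ofReal_lt_top⟩
  have hsq : ∫ ω, (displacedLattice U Z ω B).toReal ^ 2 ∂P =
      (∫⁻ ω, (displacedLattice U Z ω B) ^ 2 ∂P).toReal := by
    simp_rw [← ENNReal.toReal_pow]
    exact integral_toReal (hmeas.pow_const 2).aemeasurable
      (hfin.mono fun ω hω => ENNReal.pow_lt_top hω)
  have hmean : ∫ ω, (displacedLattice U Z ω B).toReal ∂P = (volume B).toReal := by
    rw [integral_toReal hmeas.aemeasurable hfin,
      lintegral_displacedLattice_apply hU hUunif hZ hZstat hindep hB]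
  have hLp : MemLp (fun ω => (displacedLattice U Z ω B).toReal) 2 P := by
    rw [memLp_two_iff_integrable_sq hmeas.ennreal_toReal.aestronglyMeasurable]
    simp_rw [← ENNReal.toReal_pow]
    exact integrable_toReal_of_lintegral_ne_top (hmeas.pow_const 2).aemeasurable
      (hle.trans_lt htop).ne
  rw [variance_eq_sub hLp]
  simp only [Pi.pow_apply]
  rw [hsq, hmean]
  have h := ENNReal.toReal_mono htop.ne hle
  rw [ENNReal.toReal_add hM.ne (ENNReal.mul_lt_top hV ENNReal.ofReal_lt_top).ne,
    ENNReal.toReal_mul, ENNReal.toReal_ofReal (tsum_nonneg herr)] at h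
  linarith

lemma isHyperuniform_displacedLattice (hU : Measurable U)
    (hUunif : pdf.IsUniform U (unitCube d) P volume)
    (hZ : ∀ x, Measurable (Z x)) (hZstat : IsStationaryField P Z)
    (hindep : IndepFun U (fun ω x => Z x ω) P)
    (hmix : ∑' y : Fin d → ℤ,
      tvNormSub (P.map (fun ω => (Z y ω, Z 0 ω))) ((P.map (Z 0)).prod (P.map (Z 0))) < ∞)
    {W : Set (EuclideanSpace ℝ (Fin d))} (hW : IsConvexWindow W) (hWF : IsFourierSmooth W) :
    IsHyperuniform P (displacedLattice U Z) W := by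
  refine ⟨isLocallySquareIntegrable_displacedLattice hU hUunif hZ hZstat hindep hmix, ?_⟩
  have hV := hW.volume_toReal_pos
  have hWm := hWF.1
  have hWb := hWF.2.1
  obtain ⟨C, θ, hθ, hC⟩ := exists_lattice_variance_le hWF
  have hbound : ∀ (r : ℝ) z, decouplingError P Z (r • W) z ≤
      (tvNormSub (P.map fun ω => (Z z ω, Z 0 ω)) ((P.map (Z 0)).prod (P.map (Z 0)))).toReal :=
    fun r z => (ENNReal.ofReal_le_iff_le_toReal (ENNReal.ne_top_of_tsum_ne_top hmix.ne z)).1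
      (ofReal_decouplingError_le (hWm.const_smul₀ r) (hWb.smul₀ r) z)
  have hsummable := ENNReal.summable_toReal hmix.ne
  -- Dominated convergence for series, with the total variation norms as majorant; here the mixing
  -- assumption is decisive.
  have herr : Tendsto (fun r : ℝ => ∑' z, decouplingError P Z (r • W) z) atTop (𝓝 0) := by
    have := tendsto_tsum_of_dominated_convergence hsummable
      (fun z => tendsto_decouplingError (P := P) hZ hW hWm z)
      (Eventually.of_forall fun r z => by
        rw [Real.norm_of_nonneg (decouplingError_nonneg _ _)]
        exact hbound r z)
    simpa using this
  -- This is the lattice bound `C r^(d-θ)` divided by `λ(rW) = r^d λ(W)`.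
  have hpow : Tendsto (fun r : ℝ => C / (volume W).toReal * r ^ (-θ)) atTop (𝓝 0) := by
    simpa using (tendsto_rpow_neg_atTop hθ).const_mul (C / (volume W).toReal)
  have hlim := hpow.add herr
  rw [add_zero] at hlim
  refine squeeze_zero' (Eventually.of_forall fun r =>
    mul_nonneg (inv_nonneg.2 ENNReal.toReal_nonneg) (variance_nonneg _ _)) ?_ hlim
  filter_upwards [eventually_gt_atTop 0] with r hr
  have hvar := variance_displacedLattice_le hU hUunif hZ hZstat hindep (hWm.const_smul₀ r)
    (hWb.smul₀ r) (hsummable.of_nonneg_of_le (fun z => decouplingError_nonneg _ z) (hbound r))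
  have hrV : 0 < (volume (r • W)).toReal := by
    rw [volume_smul_toReal hr.le]
    positivity
  rw [inv_mul_le_iff₀ hrV]
  refine hvar.trans ?_
  rw [mul_add]
  gcongr
  refine (hC r hr).trans (le_of_eq ?_)
  rw [volume_smul_toReal hr.le, sub_eq_add_neg, Real.rpow_add hr, Real.rpow_natCast]
  field_simp

end SecondMoment

theorem theorem5p5 {d : ℕ} {Ω : Type*} [MeasurableSpace Ω] (P : Measure Ω)
    [IsProbabilityMeasure P]
    (U : Ω → EuclideanSpace ℝ (Fin d)) (hU : Measurable U)
    (hUunif : pdf.IsUniform U (unitCube d) P volume)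
    (Z : (Fin d → ℤ) → Ω → EuclideanSpace ℝ (Fin d)) (hZ : ∀ x, Measurable (Z x))
    (hZstat : IsStationaryField P Z)
    (hindep : IndepFun U (fun ω x => Z x ω) P)
    (hmix : ∑' y : Fin d → ℤ,
      tvNormSub (P.map (fun ω => (Z y ω, Z 0 ω))) ((P.map (Z 0)).prod (P.map (Z 0))) < ∞) :
    IsPointProcess P (displacedLattice U Z) ∧
      IsStationaryMeasure P (displacedLattice U Z) ∧
      ∀ W : Set (EuclideanSpace ℝ (Fin d)), IsConvexWindow W → IsFourierSmooth W →
        IsHyperuniform P (displacedLattice U Z) W :=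
  ⟨isPointProcess_displacedLattice hU hUunif hZ hZstat hindep,
    isStationaryMeasure_displacedLattice hU hUunif hZ hZstat hindep,
    fun _W hW hWF =>
      isHyperuniform_displacedLattice hU hUunif hZ hZstat hindep hmix hW hWF⟩
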